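/- **Theorem (Comparison of spans and bisets).** A finite groupoid is a groupoid with finitely many objects and finitely many arrows. Let $\mathsf{Span}$ be the bicategory whose objects are the finite groupoids; whose 1-cells $H\to G$ are spans $H\xleftarrow{b}S\xrightarrow{a}G$ of functors between finite groupoids; whose 2-cells $(b,a)\Rightarrow(b',a')$ are the classes $[f,\beta,\alpha]$ of diagrams consisting of a functor $f\colon S\to S'$ and natural isomorphisms $\beta\colon b\Rightarrow b'f$ and $\alpha\colon a'f\Rightarrow a$, two such diagrams being identified when there is a natural isomorphism between their functors $f$ compatible with the $\alpha$'s and $\beta$'s; and whose horizontal composition of $K\xleftarrow{d}T\xrightarrow{c}H$ with $H\xleftarrow{b}S\xrightarrow{a}G$ is given by the iso-comma groupoid $c/b$, with objects $(t,s,\gamma\colon c(t)\to b(s))$. Let $\mathsf{Biset}$ be the bicategory with the same objects, whose 1-cells $H\to G$ are functors $U\colon H^{\mathrm{op}}\times G\to\mathsf{set}$ into finite sets, whose 2-cells are natural transformations, and whose horizontal composition of $V\colon K\to H$ and $U\colon H\to G$ is the coend $U\circ V=\int^{h\in H}U(h,-)\times V(-,h)$. There exists a pseudo-functor $\mathcal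 R\colon\mathsf{Span}\to\mathsf{Biset}$ which is the identity on objects, which sends a span $H\xleftarrow{b}S\xrightarrow{a}G$ to the coend $$\mathcal R(b,a)=\int^{s\in S}G(as,-)\times H(-,bs)\colon H^{\mathrm{op}}\times G\to\mathsf{set},$$ and which sends a 2-cell $[f,\beta,\alpha]$ to the natural transformation $[\xi,\zeta]_s\mapsto[\xi\circ\alpha_s,\ \beta_s\circ\zeta]_{f(s)}$, where $\xi\in G(as,g)$ and $\zeta\in H(h,bs)$. Moreover, every biset is canonically isomorphic to the realization of a span. Namely, for a biset $U\colon H^{\mathrm{op}}\times G\to\mathsf{set}$, let $S(U)$ be the finite groupoid whose objects are the elements $x\in U(h,g)$ for $h\in H$, $g\in G$, and whose arrows from $x\in U(h,g)$ to $x'\in U(h',g')$ are the pairs $(\beta,\alpha)\in H(h,h')\times G(g,g')$ with $U(\mathrm{id},\alpha)(x)=U(\beta,\mathrm{id})(x')$, and let $q\colon S(U)\to H$ and $p\colon S(U)\to G$ be the projections. Then $[\alpha,\beta]_x\mapsto U(\beta,\alpha)(x)$, for $\alpha\in G(px,g)$ and $\beta\in H(h,qx)$, is a well-defined isomorphism of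 bisets $\mathcal R(q,p)\cong U$. -/

import Mathlib

open CategoryTheory Opposite

universe u

/-- A finite groupoid: finitely many objects and finitely many arrows, all of them invertible. -/
structure FinGrpd : Type (u + 1) where
  carrier : Type u
  [groupoid : Groupoid.{u} carrier]
  [finite_obj : Finite carrier]
  [finite_hom : ∀ x y : carrier, Finite (x ⟶ y)]

instance : CoeSort FinGrpd.{u} (Type u) := ⟨FinGrpd.carrier⟩

attribute [instance] FinGrpd.groupoid FinGrpd.finite_obj FinGrpd.finite_hom

/-! ### Bisets -/

/-- A finite biset `H ⟶ G`: a functor `Hᵒᵖ × G ⥤ set` with values in finite sets. -/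
abbrev FinBiset (H G : FinGrpd.{u}) : Type (u + 1) := (H : Type u)ᵒᵖ × (G : Type u) ⥤ FintypeCat.{u}

namespace FinBiset

variable {K L H G : FinGrpd.{u}}

/-- The underlying set of the value `U(h, g)`. -/
abbrev El (U : FinBiset H G) (h : H) (g : G) : Type u := (U.obj (op h, g)).obj

/-- The function `U(β, α) : U(h, g) → U(h', g')`. -/
def act (U : FinBiset H G) {h h' : H} {g g' : G} (β : h' ⟶ h) (α : g ⟶ g') (x : U.El h g) :
    U.El h' g' :=
  U.map ((β.op, α) : ((op h, g) : (H : Type u)ᵒᵖ × (G : Type u)) ⟶ (op h', g')) x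

@[simp]
theorem act_id (U : FinBiset H G) {h : H} {g : G} (x : U.El h g) : U.act (𝟙 h) (𝟙 g) x = x :=
  ConcreteCategory.congr_hom (U.map_id (op h, g)) x

@[simp]
theorem act_act (U : FinBiset H G) {h h' h'' : H} {g g' g'' : G} (β : h' ⟶ h) (α : g ⟶ g')
    (β' : h'' ⟶ h') (α' : g' ⟶ g'') (x : U.El h g) :
    U.act β' α' (U.act β α x) = U.act (β' ≫ β) (α ≫ α') x :=
  (ConcreteCategory.congr_hom (U.map_comp
    ((β.op, α) : ((op h, g) : (H : Type u)ᵒᵖ × (G : Type u)) ⟶ (op h', g'))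
    ((β'.op, α') : ((op h', g') : (H : Type u)ᵒᵖ × (G : Type u)) ⟶ (op h'', g''))) x).symm

/-- A biset from its sets of elements and its two-sided action. -/
def ofAct (E : H → G → Type u) [∀ h g, Finite (E h g)]
    (a : ∀ {h h' : H} {g g' : G}, (h' ⟶ h) → (g ⟶ g') → E h g → E h' g')
    (a_id : ∀ {h : H} {g : G} (x : E h g), a (𝟙 h) (𝟙 g) x = x)
    (a_comp : ∀ {h h' h'' : H} {g g' g'' : G} (β : h' ⟶ h) (α : g ⟶ g')
      (β' : h'' ⟶ h') (α' : g' ⟶ g'') (x : E h g),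
      a (β' ≫ β) (α ≫ α') x = a β' α' (a β α x)) : FinBiset H G where
  obj p := FintypeCat.of (E p.1.unop p.2)
  map f := FintypeCat.homMk (a f.1.unop f.2)
  map_id _ := FintypeCat.hom_ext _ _ fun x => a_id x
  map_comp f f' := FintypeCat.hom_ext _ _ fun x => a_comp f.1.unop f.2 f'.1.unop f'.2 x

/-- The component at `(h, g)` of a morphism of bisets. -/
def ev {U V : FinBiset H G} (φ : U ⟶ V) {h : H} {g : G} (x : U.El h g) : V.El h g :=
  φ.app (op h, g) x

@[simp]
theorem ev_act {U V : FinBiset H G} (φ : U ⟶ V) {h h' : H} {g g' : G} (β : h' ⟶ h) (α : g ⟶ g')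
    (x : U.El h g) : ev φ (U.act β α x) = V.act β α (ev φ x) :=
  ConcreteCategory.congr_hom (φ.naturality
    ((β.op, α) : ((op h, g) : (H : Type u)ᵒᵖ × (G : Type u)) ⟶ (op h', g'))) x

@[simp]
theorem ev_id (U : FinBiset H G) {h : H} {g : G} (x : U.El h g) : ev (𝟙 U) x = x := rfl

@[simp]
theorem ev_comp {U V W : FinBiset H G} (φ : U ⟶ V) (ψ : V ⟶ W) {h : H} {g : G} (x : U.El h g) :
    ev (φ ≫ ψ) x = ev ψ (ev φ x) := rfl

theorem ev_ext {U V : FinBiset H G} {φ ψ : U ⟶ V}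
    (w : ∀ (h : H) (g : G) (x : U.El h g), ev φ x = ev ψ x) : φ = ψ := by
  ext ⟨h, g⟩ x
  exact w h.unop g x

/-- A morphism of bisets from its components. -/
def mkHom {U V : FinBiset H G} (f : ∀ (h : H) (g : G), U.El h g → V.El h g)
    (nat : ∀ {h h' : H} {g g' : G} (β : h' ⟶ h) (α : g ⟶ g') (x : U.El h g),
      f h' g' (U.act β α x) = V.act β α (f h g x)) : U ⟶ V where
  app p := FintypeCat.homMk (f p.1.unop p.2)
  naturality _ _ m := FintypeCat.hom_ext _ _ fun x => nat m.1.unop m.2 x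

@[simp]
theorem ev_mkHom {U V : FinBiset H G} (f : ∀ (h : H) (g : G), U.El h g → V.El h g)
    (nat : ∀ {h h' : H} {g g' : G} (β : h' ⟶ h) (α : g ⟶ g') (x : U.El h g),
      f h' g' (U.act β α x) = V.act β α (f h g x)) {h : H} {g : G} (x : U.El h g) :
    ev (mkHom f nat) x = f h g x := rfl

/-- The integrand `(h', h) ↦ U(h', g) × V(k, h)` of the tensor product over `H`. -/
def integrand (V : FinBiset K H) (U : FinBiset H G) (k : K) (g : G) :
    (H : Type u)ᵒᵖ ⥤ (H : Type u) ⥤ Type u where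
  obj h' :=
    { obj := fun h => U.El h'.unop g × V.El k h
      map := fun f => ↾fun p => (p.1, V.act (𝟙 k) f p.2)
      map_id := fun h => by ext p <;> simp
      map_comp := fun f f' => by ext p <;> simp }
  map f :=
    { app := fun h => ↾fun p => (U.act f.unop (𝟙 g) p.1, p.2)
      naturality := fun h h' m => by ext p <;> simp }
  map_id h := by ext h' p <;> simp
  map_comp f f' := by ext h' p <;> simp

/-- The set `(U ⊗_H V)(k, g) = ∫^{h ∈ H} U(h, g) × V(k, h)`. -/
def Tensor (V : FinBiset K H) (U : FinBiset H G) (k : K) (g : G) : Type u :=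
  Limits.Types.coend.{u} (integrand V U k g)

/-- The class `[x, y]_h` in the coend. -/
def tmk {V : FinBiset K H} {U : FinBiset H G} {k : K} {g : G} (h : H) (x : U.El h g)
    (y : V.El k h) : Tensor V U k g :=
  Quot.mk _ ⟨h, (x, y)⟩

theorem tmk_act {V : FinBiset K H} {U : FinBiset H G} {k : K} {g : G} {h h' : H} (f : h ⟶ h')
    (x : U.El h' g) (y : V.El k h) :
    (tmk h (U.act f (𝟙 g) x) y : Tensor V U k g) = tmk h' x (V.act (𝟙 k) f y) :=
  Quot.sound (Limits.Types.coendRel.mk (F := integrand V U k g) f (x, y))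

theorem Tensor.ind {V : FinBiset K H} {U : FinBiset H G} {k : K} {g : G}
    {P : Tensor V U k g → Prop} (w : ∀ h x y, P (tmk h x y)) (t : Tensor V U k g) : P t :=
  Quot.ind (fun p => w p.1 p.2.1 p.2.2) t

/-- The universal property of the coend. -/
def Tensor.lift {V : FinBiset K H} {U : FinBiset H G} {k : K} {g : G} {X : Type u}
    (F : ∀ h, U.El h g → V.El k h → X)
    (w : ∀ {h h' : H} (f : h ⟶ h') (x : U.El h' g) (y : V.El k h),
      F h (U.act f (𝟙 g) x) y = F h' x (V.act (𝟙 k) f y)) (t : Tensor V U k g) : X :=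
  Quot.lift (fun p => F p.1 p.2.1 p.2.2) (by rintro _ _ ⟨f, p⟩; exact w f p.1 p.2) t

@[simp]
theorem Tensor.lift_tmk {V : FinBiset K H} {U : FinBiset H G} {k : K} {g : G} {X : Type u}
    (F : ∀ h, U.El h g → V.El k h → X)
    (w : ∀ {h h' : H} (f : h ⟶ h') (x : U.El h' g) (y : V.El k h),
      F h (U.act f (𝟙 g) x) y = F h' x (V.act (𝟙 k) f y)) (h : H) (x : U.El h g) (y : V.El k h) :
    Tensor.lift F w (tmk h x y) = F h x y := rfl

instance (V : FinBiset K H) (U : FinBiset H G) (k : K) (g : G) : Finite (Tensor V U k g) :=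
  Finite.of_surjective (fun p : Σ h : H, U.El h g × V.El k h => tmk p.1 p.2.1 p.2.2)
    fun t => by
      induction t using Tensor.ind with
      | w h x y => exact ⟨⟨h, (x, y)⟩, rfl⟩

/-- The composite `V ≫ U = U ⊗_H V` of bisets `V : K ⟶ H` and `U : H ⟶ G`. -/
def comp (V : FinBiset K H) (U : FinBiset H G) : FinBiset K G :=
  ofAct (fun k g => Tensor V U k g)
    (fun β α => Tensor.lift (fun h x y => tmk h (U.act (𝟙 h) α x) (V.act β (𝟙 h) y)) (by
      intro h h' f x y
      simpa using tmk_act f (U.act (𝟙 h') α x) (V.act β (𝟙 h) y)))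
    (fun t => by
      induction t using Tensor.ind
      rw [Tensor.lift_tmk, act_id, act_id])
    (fun β α β' α' t => by
      induction t using Tensor.ind
      simp)

/-- The class `[x, y]_h` as an element of the composite biset. -/
def cmk {V : FinBiset K H} {U : FinBiset H G} {k : K} {g : G} (h : H) (x : U.El h g)
    (y : V.El k h) : (comp V U).El k g := tmk h x y

theorem cmk_act {V : FinBiset K H} {U : FinBiset H G} {k : K} {g : G} {h h' : H} (f : h ⟶ h')
    (x : U.El h' g) (y : V.El k h) :
    (cmk h (U.act f (𝟙 g) x) y : (comp V U).El k g) = cmk h' x (V.act (𝟙 k) f y) :=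
  tmk_act f x y

theorem comp_ind {V : FinBiset K H} {U : FinBiset H G} {k : K} {g : G}
    {P : (comp V U).El k g → Prop} (w : ∀ h x y, P (cmk h x y)) (t : (comp V U).El k g) : P t :=
  Tensor.ind w t

@[simp]
theorem act_cmk {V : FinBiset K H} {U : FinBiset H G} {k k' : K} {g g' : G} (β : k' ⟶ k)
    (α : g ⟶ g') (h : H) (x : U.El h g) (y : V.El k h) :
    (comp V U).act β α (cmk h x y) = cmk h (U.act (𝟙 h) α x) (V.act β (𝟙 h) y) := rfl

/-- A morphism out of a composite biset from its effect on classes `[x, y]_h`. -/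
def compDesc {V : FinBiset K H} {U : FinBiset H G} {W : FinBiset K G}
    (F : ∀ {k : K} {g : G} (h : H), U.El h g → V.El k h → W.El k g)
    (w : ∀ {k : K} {g : G} {h h' : H} (f : h ⟶ h') (x : U.El h' g) (y : V.El k h),
      F h (U.act f (𝟙 g) x) y = F h' x (V.act (𝟙 k) f y))
    (nat : ∀ {k k' : K} {g g' : G} (β : k' ⟶ k) (α : g ⟶ g') (h : H) (x : U.El h g) (y : V.El k h),
      F h (U.act (𝟙 h) α x) (V.act β (𝟙 h) y) = W.act β α (F h x y)) : comp V U ⟶ W :=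
  mkHom (fun _ _ => Tensor.lift (fun h => F h) w) (fun β α t => by
    induction t using comp_ind with
    | w h x y => exact nat β α h x y)

@[simp]
theorem ev_compDesc {V : FinBiset K H} {U : FinBiset H G} {W : FinBiset K G}
    (F : ∀ {k : K} {g : G} (h : H), U.El h g → V.El k h → W.El k g)
    (w : ∀ {k : K} {g : G} {h h' : H} (f : h ⟶ h') (x : U.El h' g) (y : V.El k h),
      F h (U.act f (𝟙 g) x) y = F h' x (V.act (𝟙 k) f y))
    (nat : ∀ {k k' : K} {g g' : G} (β : k' ⟶ k) (α : g ⟶ g') (h : H) (x : U.El h g) (y : V.El k h),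
      F h (U.act (𝟙 h) α x) (V.act β (𝟙 h) y) = W.act β α (F h x y))
    {k : K} {g : G} (h : H) (x : U.El h g) (y : V.El k h) :
    ev (compDesc F w nat) (cmk h x y) = F h x y := rfl

/-- The identity biset `G(-, -)`. -/
def one (G : FinGrpd.{u}) : FinBiset G G :=
  ofAct (fun x y : G => (x ⟶ y)) (fun β α ξ => β ≫ ξ ≫ α) (by simp) (by simp)

/-- An arrow of `G` as an element of the identity biset. -/
def toOne {x y : G} (ξ : x ⟶ y) : (one G).El x y := ξ

/-- An element of the identity biset as an arrow of `G`. -/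
def ofOne {x y : G} (ξ : (one G).El x y) : x ⟶ y := ξ

@[simp]
theorem ofOne_toOne {x y : G} (ξ : x ⟶ y) : ofOne (toOne ξ) = ξ := rfl

@[simp]
theorem toOne_ofOne {x y : G} (ξ : (one G).El x y) : toOne (ofOne ξ) = ξ := rfl

@[simp]
theorem ofOne_act {x x' y y' : G} (β : x' ⟶ x) (α : y ⟶ y') (ξ : (one G).El x y) :
    ofOne ((one G).act β α ξ) = β ≫ ofOne ξ ≫ α := rfl

@[simp]
theorem act_toOne {x x' y y' : G} (β : x' ⟶ x) (α : y ⟶ y') (ξ : x ⟶ y) :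
    (one G).act β α (toOne ξ) = toOne (β ≫ ξ ≫ α) := rfl

/-- Horizontal composition of 2-cells, `[x, y]_h ↦ [ψ x, φ y]_h`. -/
def hcomp {V V' : FinBiset K H} {U U' : FinBiset H G} (φ : V ⟶ V') (ψ : U ⟶ U') :
    comp V U ⟶ comp V' U' :=
  compDesc (fun h x y => cmk h (ev ψ x) (ev φ y))
    (fun f x y => by simpa using cmk_act f (ev ψ x) (ev φ y))
    (fun β α h x y => by simp)

@[simp]
theorem ev_hcomp {V V' : FinBiset K H} {U U' : FinBiset H G} (φ : V ⟶ V') (ψ : U ⟶ U')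
    {k : K} {g : G} (h : H) (x : U.El h g) (y : V.El k h) :
    ev (hcomp φ ψ) (cmk h x y) = cmk h (ev ψ x) (ev φ y) := rfl

/-- The identification `[x, [y, z]_k]_h ↦ [[x, y]_h, z]_k` of coends. -/
def assocHom (W : FinBiset L K) (V : FinBiset K H) (U : FinBiset H G) :
    comp (comp W V) U ⟶ comp W (comp V U) :=
  compDesc (fun {_ g} h x => Tensor.lift (fun k y z => cmk k (cmk h x y : (comp V U).El k g) z)
      (fun f y z => by
        rw [← cmk_act]
        simp))
    (fun {l g h h'} f x t => by
      induction t using comp_ind with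
      | w k y z =>
        change cmk k (cmk h (U.act f (𝟙 g) x) y : (comp V U).El k g) z =
          cmk k (cmk h' x (V.act (𝟙 k) f y) : (comp V U).El k g) (W.act (𝟙 l) (𝟙 k) z)
        rw [cmk_act, act_id])
    (fun β α h x t => by
      induction t using comp_ind with
      | w k y z =>
        change cmk k (cmk h (U.act (𝟙 h) α x) (V.act (𝟙 k) (𝟙 h) y) : (comp V U).El k _)
          (W.act β (𝟙 k) z) = cmk k ((comp V U).act (𝟙 k) α (cmk h x y)) (W.act β (𝟙 k) z)
        rw [act_cmk])

@[simp]
theorem ev_assocHom (W : FinBiset L K) (V : FinBiset K H) (U : FinBiset H G) {l : L} {k : K} {h : H}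
    {g : G} (x : U.El h g) (y : V.El k h) (z : W.El l k) :
    ev (assocHom W V U) (cmk h x (cmk k y z : (comp W V).El l h)) =
      cmk k (cmk h x y : (comp V U).El k g) z := rfl

/-- The inverse identification `[[x, y]_h, z]_k ↦ [x, [y, z]_k]_h`. -/
def assocInv (W : FinBiset L K) (V : FinBiset K H) (U : FinBiset H G) :
    comp W (comp V U) ⟶ comp (comp W V) U :=
  compDesc (fun {l g} k t z => Tensor.lift (fun h x y => cmk h x (cmk k y z : (comp W V).El l h))
      (fun f x y => by
        rw [cmk_act]
        simp) t)
    (fun {l g k k'} f t z => by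
      induction t using comp_ind with
      | w h x y =>
        change cmk h (U.act (𝟙 h) (𝟙 g) x) (cmk k (V.act f (𝟙 h) y) z : (comp W V).El l h) =
          cmk h x (cmk k' y (W.act (𝟙 l) f z) : (comp W V).El l h)
        rw [act_id]
        exact congrArg (cmk h x) (cmk_act f y z))
    (fun β α k t z => by
      induction t using comp_ind with
      | w h x y =>
        change cmk h (U.act (𝟙 h) α x)
          (cmk k (V.act (𝟙 k) (𝟙 h) y) (W.act β (𝟙 k) z) : (comp W V).El _ h) =
          cmk h (U.act (𝟙 h) α x) ((comp W V).act β (𝟙 h) (cmk k y z))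
        rw [act_cmk])

@[simp]
theorem ev_assocInv (W : FinBiset L K) (V : FinBiset K H) (U : FinBiset H G) {l : L} {k : K} {h : H}
    {g : G} (x : U.El h g) (y : V.El k h) (z : W.El l k) :
    ev (assocInv W V U) (cmk k (cmk h x y : (comp V U).El k g) z) =
      cmk h x (cmk k y z : (comp W V).El l h) := rfl

theorem comp_hom_ext {V : FinBiset K H} {U : FinBiset H G} {W : FinBiset K G}
    {φ ψ : comp V U ⟶ W}
    (w : ∀ {k : K} {g : G} (h : H) (x : U.El h g) (y : V.El k h),
      ev φ (cmk h x y) = ev ψ (cmk h x y)) : φ = ψ :=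
  ev_ext fun _ _ t => comp_ind (P := fun t => ev φ t = ev ψ t) w t

/-- The associativity constraint. -/
def associator (W : FinBiset L K) (V : FinBiset K H) (U : FinBiset H G) :
    comp (comp W V) U ≅ comp W (comp V U) where
  hom := assocHom W V U
  inv := assocInv W V U
  hom_inv_id := comp_hom_ext fun h x t => by
    induction t using comp_ind
    simp
  inv_hom_id := comp_hom_ext fun h t z => by
    induction t using comp_ind
    simp

/-- The left unit constraint `[x, ξ]_h ↦ U(ξ, 1)(x)`. -/
def leftUnitor (U : FinBiset H G) : comp (one H) U ≅ U where
  hom := compDesc (fun {_ g} _ x ξ => U.act (ofOne ξ) (𝟙 g) x)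
    (fun f x ξ => by simp)
    (fun β α h x ξ => by simp)
  inv := mkHom (fun h g x => cmk h x (toOne (𝟙 h))) (fun {h h' g g'} β α x => by
    have e := cmk_act (V := one H) (U := U) (k := h') β (U.act (𝟙 h) α x) (toOne (𝟙 h'))
    rw [act_cmk]
    simpa using e)
  hom_inv_id := comp_hom_ext fun {k g} h x ξ => by
    have e := cmk_act (V := one H) (U := U) (k := k) (ofOne ξ) x (toOne (𝟙 k))
    rw [act_toOne, Category.id_comp, Category.id_comp, toOne_ofOne] at e
    exact e
  inv_hom_id := ev_ext fun h g x => by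
    rw [ev_comp, ev_mkHom, ev_compDesc]
    simp

/-- The right unit constraint `[ξ, y]_g ↦ U(1, ξ)(y)`. -/
def rightUnitor (U : FinBiset H G) : comp U (one G) ≅ U where
  hom := compDesc (fun {k _} _ ξ x => U.act (𝟙 k) (ofOne ξ) x)
    (fun f x ξ => by simp)
    (fun β α h x ξ => by simp)
  inv := mkHom (fun _ g x => cmk g (toOne (𝟙 g)) x) (fun {h h' g g'} β α x => by
    have e := cmk_act (V := U) (U := one G) (k := h') α (toOne (𝟙 g')) (U.act β (𝟙 g) x)
    rw [act_cmk]
    simpa using e.symm)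
  hom_inv_id := comp_hom_ext fun {k g} h ξ x => by
    have e := cmk_act (V := U) (U := one G) (k := k) (ofOne ξ) (toOne (𝟙 g)) x
    rw [act_toOne, Category.comp_id, Category.comp_id, toOne_ofOne] at e
    exact e.symm
  inv_hom_id := ev_ext fun h g x => by
    rw [ev_comp, ev_mkHom, ev_compDesc]
    simp

@[simp]
theorem ev_leftUnitor (U : FinBiset H G) {k h : H} {g : G} (x : U.El h g) (ξ : (one H).El k h) :
    ev (leftUnitor U).hom (cmk h x ξ) = U.act (ofOne ξ) (𝟙 g) x := rfl

@[simp]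
theorem ev_leftUnitor_inv (U : FinBiset H G) {h : H} {g : G} (x : U.El h g) :
    ev (leftUnitor U).inv x = cmk h x (toOne (𝟙 h)) := rfl

@[simp]
theorem ev_rightUnitor (U : FinBiset H G) {h : H} {k g : G} (ξ : (one G).El k g) (x : U.El h k) :
    ev (rightUnitor U).hom (cmk k ξ x) = U.act (𝟙 h) (ofOne ξ) x := rfl

@[simp]
theorem ev_rightUnitor_inv (U : FinBiset H G) {h : H} {g : G} (x : U.El h g) :
    ev (rightUnitor U).inv x = cmk g (toOne (𝟙 g)) x := rfl

@[simp]
theorem ev_associator (W : FinBiset L K) (V : FinBiset K H) (U : FinBiset H G) {l : L} {k : K}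
    {h : H} {g : G} (x : U.El h g) (y : V.El k h) (z : W.El l k) :
    ev (associator W V U).hom (cmk h x (cmk k y z : (comp W V).El l h)) =
      cmk k (cmk h x y : (comp V U).El k g) z := rfl

@[simp]
theorem ev_associator_inv (W : FinBiset L K) (V : FinBiset K H) (U : FinBiset H G) {l : L} {k : K}
    {h : H} {g : G} (x : U.El h g) (y : V.El k h) (z : W.El l k) :
    ev (associator W V U).inv (cmk k (cmk h x y : (comp V U).El k g) z) =
      cmk h x (cmk k y z : (comp W V).El l h) := rfl

/-- Left whiskering `V ≫ U ⟶ V ≫ U'`. -/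
def whiskerL (V : FinBiset K H) {U U' : FinBiset H G} (ψ : U ⟶ U') : comp V U ⟶ comp V U' :=
  hcomp (𝟙 V) ψ

/-- Right whiskering `V ≫ U ⟶ V' ≫ U`. -/
def whiskerR {V V' : FinBiset K H} (φ : V ⟶ V') (U : FinBiset H G) : comp V U ⟶ comp V' U :=
  hcomp φ (𝟙 U)

@[simp]
theorem ev_whiskerL (V : FinBiset K H) {U U' : FinBiset H G} (ψ : U ⟶ U') {k : K} {g : G} (h : H)
    (x : U.El h g) (y : V.El k h) : ev (whiskerL V ψ) (cmk h x y) = cmk h (ev ψ x) y := rfl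

@[simp]
theorem ev_whiskerR {V V' : FinBiset K H} (φ : V ⟶ V') (U : FinBiset H G) {k : K} {g : G} (h : H)
    (x : U.El h g) (y : V.El k h) : ev (whiskerR φ U) (cmk h x y) = cmk h x (ev φ y) := rfl

theorem id_whiskerL {U U' : FinBiset H G} (φ : U ⟶ U') :
    whiskerL (one H) φ = (leftUnitor U).hom ≫ φ ≫ (leftUnitor U').inv := by
  rw [← Category.assoc, Iso.eq_comp_inv]
  exact comp_hom_ext fun h x ξ => (ev_act φ (ofOne ξ) (𝟙 _) x).symm

theorem whiskerR_id {U U' : FinBiset H G} (φ : U ⟶ U') :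
    whiskerR φ (one G) = (rightUnitor U).hom ≫ φ ≫ (rightUnitor U').inv := by
  rw [← Category.assoc, Iso.eq_comp_inv]
  exact comp_hom_ext fun h ξ x => (ev_act φ (𝟙 _) (ofOne ξ) x).symm

theorem triangle_eq (V : FinBiset K H) (U : FinBiset H G) :
    (associator V (one H) U).hom ≫ whiskerL V (leftUnitor U).hom =
      whiskerR (rightUnitor V).hom U :=
  comp_hom_ext fun h x t => by
    induction t using comp_ind with
    | w k ξ y => exact cmk_act (ofOne ξ) x y

end FinBiset

/-- The objects of the bicategory of bisets: all finite groupoids. -/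
def BisetBicat : Type (u + 1) := FinGrpd.{u}

namespace BisetBicat

open FinBiset

instance : CategoryStruct.{u + 1} BisetBicat.{u} where
  Hom H G := FinBiset H G
  id G := one G
  comp V U := comp V U

/-- The bicategory of bisets: 1-cells `H ⟶ G` are finite bisets `Hᵒᵖ × G ⥤ set`, 2-cells are natural
transformations, and horizontal composition is the tensor product (coend). -/
instance : Bicategory.{u, u + 1} BisetBicat.{u} where
  homCategory H G := inferInstanceAs (Category (FinBiset H G))
  whiskerLeft V _ _ ψ := whiskerL V ψ
  whiskerRight φ U := whiskerR φ U
  associator W V U := associator W V U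
  leftUnitor U := leftUnitor U
  rightUnitor U := rightUnitor U
  whiskerLeft_id _ _ := comp_hom_ext fun _ _ _ => rfl
  whiskerLeft_comp _ _ _ _ _ _ := comp_hom_ext fun _ _ _ => rfl
  id_whiskerLeft φ := id_whiskerL φ
  comp_whiskerLeft _ _ _ _ _ := comp_hom_ext fun _ _ t => by
    induction t using comp_ind
    rfl
  id_whiskerRight _ _ := comp_hom_ext fun _ _ _ => rfl
  comp_whiskerRight _ _ _ := comp_hom_ext fun _ _ _ => rfl
  whiskerRight_id φ := whiskerR_id φ
  whiskerRight_comp _ _ _ := comp_hom_ext fun _ t _ => by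
    induction t using comp_ind
    rfl
  whisker_assoc _ _ _ _ _ := comp_hom_ext fun _ _ t => by
    induction t using comp_ind
    rfl
  whisker_exchange _ _ := comp_hom_ext fun _ _ _ => rfl
  pentagon _ _ _ _ := comp_hom_ext fun _ _ t => by
    induction t using comp_ind with
    | w k y t =>
      induction t using comp_ind
      rfl
  triangle V U := triangle_eq V U

end BisetBicat

/-! ### Spans -/

section IsoComma

variable {S T G : FinGrpd.{u}} (a : (S : Type u) ⥤ (G : Type u)) (b : (T : Type u) ⥤ (G : Type u))

/-- The category `a/b` of triples `(s, t, γ : a s ⟶ b t)` of a cospan of groupoids is a groupoid. -/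
instance isoCommaGroupoid : Groupoid.{u} (Comma a b) where
  inv {x y} f :=
    { left := Groupoid.inv f.left
      right := Groupoid.inv f.right
      w := by
        have h := f.w
        rw [Groupoid.inv_eq_inv, Groupoid.inv_eq_inv, Functor.map_inv, Functor.map_inv,
          IsIso.inv_comp_eq, ← Category.assoc, IsIso.eq_comp_inv]
        exact h.symm }
  inv_comp f := by ext <;> simp
  comp_inv f := by ext <;> simp

/-- The iso-comma groupoid `a/b`. -/
abbrev isoComma : FinGrpd.{u} where
  carrier := Comma a b
  finite_obj := Finite.of_injective
    (fun x : Comma a b => (⟨x.left, x.right, x.hom⟩ : Σ s : S, Σ t : T, (a.obj s ⟶ b.obj t))) (by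
      rintro ⟨s, t, γ⟩ ⟨s', t', γ'⟩ e
      simp only [Sigma.mk.injEq] at e
      obtain ⟨rfl, e⟩ := e
      simp only [heq_eq_eq, Sigma.mk.injEq] at e
      obtain ⟨rfl, e⟩ := e
      simp only [heq_eq_eq] at e
      rw [e])
  finite_hom x y := Finite.of_injective
    (fun f : x ⟶ y => ((f.left, f.right) : (x.left ⟶ y.left) × (x.right ⟶ y.right)))
    fun f g e => CommaMorphism.ext (congrArg Prod.fst e) (congrArg Prod.snd e)

end IsoComma

/-- A span `H ← S → G` of finite groupoids, as a 1-cell from `H` to `G`. -/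
structure FinSpan (H G : FinGrpd.{u}) : Type (u + 1) where
  apex : FinGrpd.{u}
  /-- the leg `b : S ⥤ H` -/
  left : (apex : Type u) ⥤ (H : Type u)
  /-- the leg `a : S ⥤ G` -/
  right : (apex : Type u) ⥤ (G : Type u)

/-- A diagram representing a 2-cell of spans `(b, a) ⟶ (b', a')`: a functor `f` between the apices
and two natural transformations `β : b ⟶ b' f` and `α : a' f ⟶ a` (automatically invertible, since
they take values in groupoids). -/
structure SpanDiagram {H G : FinGrpd.{u}} (S S' : FinSpan H G) : Type u where
  f : (S.apex : Type u) ⥤ (S'.apex : Type u)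
  β : S.left ⟶ f ⋙ S'.left
  α : f ⋙ S'.right ⟶ S.right

namespace SpanDiagram

variable {K L H G : FinGrpd.{u}}

/-- Two diagrams are isomorphic if some natural isomorphism between their functors identifies their
natural transformations. -/
def Isomorphic {S S' : FinSpan H G} (D E : SpanDiagram S S') : Prop :=
  ∃ θ : D.f ≅ E.f, (∀ s, D.β.app s ≫ S'.left.map (θ.hom.app s) = E.β.app s) ∧
    ∀ s, S'.right.map (θ.hom.app s) ≫ E.α.app s = D.α.app s

/-- Isomorphism of diagrams is an equivalence relation. -/
instance setoid (S S' : FinSpan H G) : Setoid (SpanDiagram S S') where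
  r := Isomorphic
  iseqv :=
    { refl := fun D => ⟨Iso.refl _, by simp, by simp⟩
      symm := by
        rintro D E ⟨θ, h, k⟩
        refine ⟨θ.symm, fun s => ?_, fun s => ?_⟩
        · rw [← h, Category.assoc, ← Functor.map_comp]
          simp
        · rw [← k, ← Category.assoc, ← Functor.map_comp]
          simp
      trans := by
        rintro D E F ⟨θ, h, k⟩ ⟨θ', h', k'⟩
        refine ⟨θ ≪≫ θ', fun s => ?_, fun s => ?_⟩
        · rw [← h', ← h]
          simp
        · rw [← k, ← k']
          simp }

theorem rel_mk {S S' : FinSpan H G} {D E : SpanDiagram S S'} (θ : ∀ s, D.f.obj s ⟶ E.f.obj s)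
    (nat : ∀ {s t} (m : s ⟶ t), D.f.map m ≫ θ t = θ s ≫ E.f.map m)
    (h : ∀ s, D.β.app s ≫ S'.left.map (θ s) = E.β.app s)
    (k : ∀ s, S'.right.map (θ s) ≫ E.α.app s = D.α.app s) : D ≈ E :=
  ⟨NatIso.ofComponents (fun s => asIso (θ s)) nat, h, k⟩

theorem rel_congr {S S' : FinSpan H G} {f : (S.apex : Type u) ⥤ (S'.apex : Type u)}
    {β β' : S.left ⟶ f ⋙ S'.left} {α α' : f ⋙ S'.right ⟶ S.right}
    (h : ∀ s, β.app s = β'.app s) (k : ∀ s, α.app s = α'.app s) :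
    (⟨f, β, α⟩ : SpanDiagram S S') ≈ ⟨f, β', α'⟩ := by
  obtain rfl : β = β' := NatTrans.ext (funext h)
  obtain rfl : α = α' := NatTrans.ext (funext k)
  exact Setoid.refl _

/-- The identity diagram. -/
def id (S : FinSpan H G) : SpanDiagram S S where
  f := 𝟭 _
  β := 𝟙 _
  α := 𝟙 _

/-- Vertical pasting of diagrams. -/
def comp {S S' S'' : FinSpan H G} (D : SpanDiagram S S') (E : SpanDiagram S' S'') :
    SpanDiagram S S'' where
  f := D.f ⋙ E.f
  β :=
    { app := fun s => D.β.app s ≫ E.β.app (D.f.obj s)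
      naturality := fun s t m => by
        have := E.β.naturality (D.f.map m)
        have := D.β.naturality m
        simp_all }
  α :=
    { app := fun s => E.α.app (D.f.obj s) ≫ D.α.app s
      naturality := fun s t m => by
        have h := E.α.naturality (D.f.map m)
        have := D.α.naturality m
        simp only [Functor.comp_map] at h this ⊢
        rw [← Category.assoc, h, Category.assoc, this, Category.assoc] }

theorem comp_rel {S S' S'' : FinSpan H G} {D D' : SpanDiagram S S'} {E E' : SpanDiagram S' S''}
    (hD : D ≈ D') (hE : E ≈ E') : D.comp E ≈ D'.comp E' := by
  obtain ⟨θ, h, k⟩ := hD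
  obtain ⟨θ', h', k'⟩ := hE
  refine rel_mk (fun s => θ'.hom.app (D.f.obj s) ≫ E'.f.map (θ.hom.app s)) (fun {s t} m => ?_)
    (fun s => ?_) (fun s => ?_)
  · simp [comp, ← Functor.map_comp]
  · have n := E'.β.naturality (θ.hom.app s)
    simp only [Functor.comp_map] at n
    simp only [comp, Functor.map_comp, Category.assoc]
    rw [reassoc_of% (h' (D.f.obj s)), ← n, reassoc_of% (h s)]
  · have n := E'.α.naturality (θ.hom.app s)
    simp only [Functor.comp_map] at n
    simp only [comp, Functor.map_comp, Category.assoc]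
    rw [reassoc_of% n, k s, reassoc_of% (k' (D.f.obj s))]

end SpanDiagram

section Aux

variable {C D E : Type u} [Category.{u} C] [Category.{u} D] [Category.{u} E]

theorem nat_id_aux {x y : C} (m : x ⟶ y) : m ≫ 𝟙 y = 𝟙 x ≫ m := by simp

theorem sq_id_aux (F : C ⥤ E) (F' : D ⥤ E) {x : C} {y : D} {m n : F.obj x ⟶ F'.obj y} (h : n = m) :
    F.map (𝟙 x) ≫ m = n ≫ F'.map (𝟙 y) := by simp [h]

theorem comp_map_id_aux (F : C ⥤ E) {x : C} {e : E} {m n : e ⟶ F.obj x} (h : m = n) :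
    m ≫ F.map (𝟙 x) = n := by simp [h]

theorem map_id_comp_aux (F : C ⥤ E) {x : C} {e : E} {m n : F.obj x ⟶ e} (h : m = n) :
    F.map (𝟙 x) ≫ m = n := by simp [h]

end Aux

namespace FinSpan

variable {K L H G : FinGrpd.{u}}

/-- A 2-cell of spans: an isomorphism class of diagrams. -/
def Cell (S S' : FinSpan H G) : Type u := Quotient (SpanDiagram.setoid S S')

/-- The 2-cell `[f, β, α]` represented by a diagram. -/
def cell {S S' : FinSpan H G} (D : SpanDiagram S S') : Cell S S' := Quotient.mk _ D

/-- The category of spans from `H` to `G` and 2-cells. -/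
instance category (H G : FinGrpd.{u}) : Category.{u} (FinSpan H G) where
  Hom S S' := Cell S S'
  id S := cell (SpanDiagram.id S)
  comp := Quotient.map₂ SpanDiagram.comp fun _ _ hD _ _ hE => SpanDiagram.comp_rel hD hE
  id_comp := by
    rintro S S' ⟨D⟩
    exact Quotient.sound (SpanDiagram.rel_mk (fun _ => 𝟙 _)
      (by simp [SpanDiagram.comp, SpanDiagram.id]) (by simp [SpanDiagram.comp, SpanDiagram.id])
      (by simp [SpanDiagram.comp, SpanDiagram.id]))
  comp_id := by
    rintro S S' ⟨D⟩
    exact Quotient.sound (SpanDiagram.rel_mk (fun _ => 𝟙 _)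
      (by simp [SpanDiagram.comp, SpanDiagram.id]) (by simp [SpanDiagram.comp, SpanDiagram.id])
      (by simp [SpanDiagram.comp, SpanDiagram.id]))
  assoc := by
    rintro S S' S'' S''' ⟨D⟩ ⟨E⟩ ⟨F⟩
    exact Quotient.sound (SpanDiagram.rel_mk (fun _ => 𝟙 _)
      (by simp [SpanDiagram.comp]) (by simp [SpanDiagram.comp]) (by simp [SpanDiagram.comp]))

/-- The class `[f, β, α]` as an arrow of the category of spans. -/
def homOf {S S' : FinSpan H G} (D : SpanDiagram S S') : S ⟶ S' := cell D

theorem homOf_eq {S S' : FinSpan H G} {D E : SpanDiagram S S'} (h : D ≈ E) : homOf D = homOf E :=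
  Quotient.sound h

theorem hom_ind {S S' : FinSpan H G} {P : (S ⟶ S') → Prop}
    (w : ∀ D : SpanDiagram S S', P (homOf D)) (φ : S ⟶ S') : P φ :=
  Quotient.ind w φ

/-- The identity span `G = G = G`. -/
abbrev one (G : FinGrpd.{u}) : FinSpan G G := ⟨G, 𝟭 _, 𝟭 _⟩

/-- The composite of `K ← T → H` and `H ← S → G`, through the iso-comma groupoid over `H`. -/
abbrev comp (T : FinSpan K H) (S : FinSpan H G) : FinSpan K G where
  apex := isoComma T.right S.left
  left := Comma.fst _ _ ⋙ T.left
  right := Comma.snd _ _ ⋙ S.right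

theorem rel_comp {X : FinSpan K G} {T : FinSpan K H} {S : FinSpan H G}
    {D E : SpanDiagram X (comp T S)}
    (l : ∀ x, (D.f.obj x).left ⟶ (E.f.obj x).left) (r : ∀ x, (D.f.obj x).right ⟶ (E.f.obj x).right)
    (w : ∀ x, T.right.map (l x) ≫ (E.f.obj x).hom = (D.f.obj x).hom ≫ S.left.map (r x))
    (natl : ∀ {x y} (m : x ⟶ y), (D.f.map m).left ≫ l y = l x ≫ (E.f.map m).left)
    (natr : ∀ {x y} (m : x ⟶ y), (D.f.map m).right ≫ r y = r x ≫ (E.f.map m).right)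
    (h : ∀ x, D.β.app x ≫ T.left.map (l x) = E.β.app x)
    (k : ∀ x, S.right.map (r x) ≫ E.α.app x = D.α.app x) : D ≈ E :=
  SpanDiagram.rel_mk (fun x => (⟨l x, r x, w x⟩ : CommaMorphism (D.f.obj x) (E.f.obj x)))
    (fun m => CommaMorphism.ext (natl m) (natr m)) h k

/-- Left whiskering of diagrams, `(t, s, γ) ↦ (t, f s, β_s γ)`. -/
def whiskerLD (T : FinSpan K H) {S S' : FinSpan H G} (D : SpanDiagram S S') :
    SpanDiagram (comp T S) (comp T S') where
  f :=
    { obj := fun x => ⟨x.left, D.f.obj x.right, x.hom ≫ D.β.app x.right⟩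
      map := fun {x y} m => ⟨m.left, D.f.map m.right, by
        have h := D.β.naturality m.right
        have w := m.w
        simp only [Functor.comp_map] at h w ⊢
        rw [reassoc_of% w, h, Category.assoc]⟩
      map_id := fun x => CommaMorphism.ext rfl (D.f.map_id _)
      map_comp := fun m n => CommaMorphism.ext rfl (D.f.map_comp _ _) }
  β :=
    { app := fun x => 𝟙 (T.left.obj x.left)
      naturality := fun _ _ _ => nat_id_aux _ }
  α :=
    { app := fun x => D.α.app x.right
      naturality := fun x y m => D.α.naturality m.right }

/-- Right whiskering of diagrams, `(t, s, γ) ↦ (f t, s, γ α_t)`. -/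
def whiskerRD {T T' : FinSpan K H} (D : SpanDiagram T T') (S : FinSpan H G) :
    SpanDiagram (comp T S) (comp T' S) where
  f :=
    { obj := fun x => ⟨D.f.obj x.left, x.right, D.α.app x.left ≫ x.hom⟩
      map := fun {x y} m => ⟨D.f.map m.left, m.right, by
        have h := D.α.naturality m.left
        have w := m.w
        simp only [Functor.comp_map] at h w ⊢
        rw [reassoc_of% h, w, Category.assoc]⟩
      map_id := fun x => CommaMorphism.ext (D.f.map_id _) rfl
      map_comp := fun m n => CommaMorphism.ext (D.f.map_comp _ _) rfl }
  β :=
    { app := fun x => D.β.app x.left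
      naturality := fun x y m => D.β.naturality m.left }
  α :=
    { app := fun x => 𝟙 (S.right.obj x.right)
      naturality := fun _ _ _ => nat_id_aux _ }

theorem whiskerLD_rel (T : FinSpan K H) {S S' : FinSpan H G} {D E : SpanDiagram S S'} (h : D ≈ E) :
    whiskerLD T D ≈ whiskerLD T E := by
  obtain ⟨θ, h, k⟩ := h
  refine rel_comp (fun x => 𝟙 x.left) (fun x => θ.hom.app x.right) (fun x => ?_)
    (fun m => nat_id_aux m.left) (fun m => θ.hom.naturality m.right)
    (fun x => comp_map_id_aux T.left rfl) (fun x => k x.right)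
  change T.right.map (𝟙 x.left) ≫ x.hom ≫ E.β.app x.right =
    (x.hom ≫ D.β.app x.right) ≫ S'.left.map (θ.hom.app x.right)
  rw [Category.assoc, h]
  exact map_id_comp_aux T.right rfl

theorem whiskerRD_rel {T T' : FinSpan K H} {D E : SpanDiagram T T'} (h : D ≈ E) (S : FinSpan H G) :
    whiskerRD D S ≈ whiskerRD E S := by
  obtain ⟨θ, h, k⟩ := h
  refine rel_comp (fun x => θ.hom.app x.left) (fun x => 𝟙 x.right) (fun x => ?_)
    (fun m => θ.hom.naturality m.left) (fun m => nat_id_aux m.right)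
    (fun x => h x.left) (fun x => map_id_comp_aux S.right rfl)
  change T'.right.map (θ.hom.app x.left) ≫ E.α.app x.left ≫ x.hom =
    (D.α.app x.left ≫ x.hom) ≫ S.left.map (𝟙 x.right)
  rw [← Category.assoc, k]
  exact (comp_map_id_aux S.left rfl).symm

/-- Left whiskering of 2-cells. -/
def whiskerL (T : FinSpan K H) {S S' : FinSpan H G} (φ : S ⟶ S') : comp T S ⟶ comp T S' :=
  Quotient.map (whiskerLD T) (fun _ _ h => whiskerLD_rel T h) φ

/-- Right whiskering of 2-cells. -/
def whiskerR {T T' : FinSpan K H} (φ : T ⟶ T') (S : FinSpan H G) : comp T S ⟶ comp T' S :=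
  Quotient.map (fun D => whiskerRD D S) (fun _ _ h => whiskerRD_rel h S) φ

/-- The diagram of `((r, t, δ), s, γ) ↦ (r, (t, s, γ), δ)`. -/
def assocD (R : FinSpan L K) (T : FinSpan K H) (S : FinSpan H G) :
    SpanDiagram (comp (comp R T) S) (comp R (comp T S)) where
  f :=
    { obj := fun x => ⟨x.left.left, ⟨x.left.right, x.right, x.hom⟩, x.left.hom⟩
      map := fun m => ⟨m.left.left, ⟨m.left.right, m.right, m.w⟩, m.left.w⟩
      map_id := fun _ => rfl
      map_comp := fun _ _ => rfl }
  β :=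
    { app := fun x => 𝟙 (R.left.obj x.left.left)
      naturality := fun _ _ _ => nat_id_aux _ }
  α :=
    { app := fun x => 𝟙 (S.right.obj x.right)
      naturality := fun _ _ _ => nat_id_aux _ }

/-- The diagram of `(r, (t, s, γ), δ) ↦ ((r, t, δ), s, γ)`. -/
def assocInvD (R : FinSpan L K) (T : FinSpan K H) (S : FinSpan H G) :
    SpanDiagram (comp R (comp T S)) (comp (comp R T) S) where
  f :=
    { obj := fun x => ⟨⟨x.left, x.right.left, x.hom⟩, x.right.right, x.right.hom⟩
      map := fun m => ⟨⟨m.left, m.right.left, m.w⟩, m.right.right, m.right.w⟩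
      map_id := fun _ => rfl
      map_comp := fun _ _ => rfl }
  β :=
    { app := fun x => 𝟙 (R.left.obj x.left)
      naturality := fun _ _ _ => nat_id_aux _ }
  α :=
    { app := fun x => 𝟙 (S.right.obj x.right.right)
      naturality := fun _ _ _ => nat_id_aux _ }

/-- The associativity constraint. -/
def associator (R : FinSpan L K) (T : FinSpan K H) (S : FinSpan H G) :
    comp (comp R T) S ≅ comp R (comp T S) where
  hom := homOf (assocD R T S)
  inv := homOf (assocInvD R T S)
  hom_inv_id := homOf_eq (SpanDiagram.rel_congr (fun _ => Category.comp_id _)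
    (fun _ => Category.comp_id _))
  inv_hom_id := homOf_eq (SpanDiagram.rel_congr (fun _ => Category.comp_id _)
    (fun _ => Category.comp_id _))

/-- The diagram of `(h, s, γ : h ⟶ b s) ↦ s`. -/
def leftUnitorD (S : FinSpan H G) : SpanDiagram (comp (one H) S) S where
  f := Comma.snd _ _
  β := { app := fun x => x.hom, naturality := fun _ _ m => m.w }
  α :=
    { app := fun x => 𝟙 (S.right.obj x.right)
      naturality := fun _ _ _ => nat_id_aux _ }

/-- The diagram of `s ↦ (b s, s, 1)`. -/
def leftUnitorInvD (S : FinSpan H G) : SpanDiagram S (comp (one H) S) where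
  f :=
    { obj := fun s => ⟨S.left.obj s, s, 𝟙 (S.left.obj s)⟩
      map := fun m => ⟨S.left.map m, m, by simp⟩
      map_id := fun _ => CommaMorphism.ext (S.left.map_id _) rfl
      map_comp := fun _ _ => CommaMorphism.ext (S.left.map_comp _ _) rfl }
  β :=
    { app := fun s => 𝟙 (S.left.obj s)
      naturality := fun _ _ _ => nat_id_aux _ }
  α :=
    { app := fun s => 𝟙 (S.right.obj s)
      naturality := fun _ _ _ => nat_id_aux _ }

/-- The diagram of `(s, g, γ : a s ⟶ g) ↦ s`. -/
def rightUnitorD (S : FinSpan H G) : SpanDiagram (comp S (one G)) S where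
  f := Comma.fst _ _
  β :=
    { app := fun x => 𝟙 (S.left.obj x.left)
      naturality := fun _ _ _ => nat_id_aux _ }
  α := { app := fun x => x.hom, naturality := fun _ _ m => m.w }

/-- The diagram of `s ↦ (s, a s, 1)`. -/
def rightUnitorInvD (S : FinSpan H G) : SpanDiagram S (comp S (one G)) where
  f :=
    { obj := fun s => ⟨s, S.right.obj s, 𝟙 (S.right.obj s)⟩
      map := fun m => ⟨m, S.right.map m, by simp⟩
      map_id := fun _ => CommaMorphism.ext rfl (S.right.map_id _)
      map_comp := fun _ _ => CommaMorphism.ext rfl (S.right.map_comp _ _) }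
  β :=
    { app := fun s => 𝟙 (S.left.obj s)
      naturality := fun _ _ _ => nat_id_aux _ }
  α :=
    { app := fun s => 𝟙 (S.right.obj s)
      naturality := fun _ _ _ => nat_id_aux _ }

/-- The left unit constraint. -/
def leftUnitor (S : FinSpan H G) : comp (one H) S ≅ S where
  hom := homOf (leftUnitorD S)
  inv := homOf (leftUnitorInvD S)
  hom_inv_id := Eq.symm (homOf_eq (rel_comp (fun x => x.hom) (fun x => 𝟙 x.right)
    (fun _ => (Category.comp_id _).trans (comp_map_id_aux S.left rfl).symm)
    (fun m => m.w) (fun m => nat_id_aux m.right)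
    (fun _ => (Category.id_comp _).trans (Category.comp_id _).symm)
    (fun _ => map_id_comp_aux S.right (Category.comp_id _))))
  inv_hom_id := homOf_eq (SpanDiagram.rel_congr (fun _ => Category.comp_id _)
    (fun _ => Category.comp_id _))

/-- The right unit constraint. -/
def rightUnitor (S : FinSpan H G) : comp S (one G) ≅ S where
  hom := homOf (rightUnitorD S)
  inv := homOf (rightUnitorInvD S)
  hom_inv_id := homOf_eq (rel_comp (fun x => 𝟙 x.left) (fun x => x.hom)
    (fun _ => (map_id_comp_aux S.right rfl).trans (Category.id_comp _).symm)
    (fun m => nat_id_aux m.left) (fun m => m.w)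
    (fun _ => comp_map_id_aux S.left (Category.comp_id _))
    (fun _ => (Category.comp_id _).trans (Category.id_comp _).symm))
  inv_hom_id := homOf_eq (SpanDiagram.rel_congr (fun _ => Category.comp_id _)
    (fun _ => Category.comp_id _))

theorem whiskerLD_id (T : FinSpan K H) (S : FinSpan H G) :
    whiskerLD T (SpanDiagram.id S) ≈ SpanDiagram.id (comp T S) :=
  rel_comp (fun x => 𝟙 x.left) (fun x => 𝟙 x.right)
    (fun _ => sq_id_aux T.right S.left (Category.comp_id _))
    (fun m => nat_id_aux m.left) (fun m => nat_id_aux m.right)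
    (fun _ => comp_map_id_aux T.left rfl) (fun _ => map_id_comp_aux S.right rfl)

theorem whiskerLD_comp (T : FinSpan K H) {S S' S'' : FinSpan H G} (D : SpanDiagram S S')
    (E : SpanDiagram S' S'') :
    whiskerLD T (D.comp E) ≈ (whiskerLD T D).comp (whiskerLD T E) :=
  rel_comp (fun x => 𝟙 x.left) (fun x => 𝟙 (E.f.obj (D.f.obj x.right)))
    (fun _ => sq_id_aux T.right S''.left (Category.assoc _ _ _).symm)
    (fun m => nat_id_aux m.left) (fun m => nat_id_aux (E.f.map (D.f.map m.right)))
    (fun _ => comp_map_id_aux T.left (Category.comp_id _).symm)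
    (fun _ => map_id_comp_aux S''.right rfl)

theorem whiskerRD_id (T : FinSpan K H) (S : FinSpan H G) :
    whiskerRD (SpanDiagram.id T) S ≈ SpanDiagram.id (comp T S) :=
  rel_comp (fun x => 𝟙 x.left) (fun x => 𝟙 x.right)
    (fun _ => sq_id_aux T.right S.left (Category.id_comp _))
    (fun m => nat_id_aux m.left) (fun m => nat_id_aux m.right)
    (fun _ => comp_map_id_aux T.left rfl) (fun _ => map_id_comp_aux S.right rfl)

theorem whiskerRD_comp {T T' T'' : FinSpan K H} (D : SpanDiagram T T') (E : SpanDiagram T' T'')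
    (S : FinSpan H G) : whiskerRD (D.comp E) S ≈ (whiskerRD D S).comp (whiskerRD E S) :=
  rel_comp (fun x => 𝟙 (E.f.obj (D.f.obj x.left))) (fun x => 𝟙 x.right)
    (fun _ => sq_id_aux T''.right S.left (Category.assoc _ _ _))
    (fun m => nat_id_aux (E.f.map (D.f.map m.left))) (fun m => nat_id_aux m.right)
    (fun _ => comp_map_id_aux T''.left rfl)
    (fun _ => map_id_comp_aux S.right (Category.comp_id _))

theorem exchangeD {T T' : FinSpan K H} {S S' : FinSpan H G} (D : SpanDiagram T T')
    (E : SpanDiagram S S') :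
    (whiskerLD T E).comp (whiskerRD D S') ≈ (whiskerRD D S).comp (whiskerLD T' E) :=
  rel_comp (fun x => 𝟙 (D.f.obj x.left)) (fun x => 𝟙 (E.f.obj x.right))
    (fun _ => sq_id_aux T'.right S'.left (Category.assoc _ _ _).symm)
    (fun m => nat_id_aux (D.f.map m.left)) (fun m => nat_id_aux (E.f.map m.right))
    (fun _ => comp_map_id_aux T'.left (nat_id_aux _).symm)
    (fun _ => map_id_comp_aux S'.right (nat_id_aux _))

theorem id_whiskerLD {S S' : FinSpan H G} (D : SpanDiagram S S') :
    whiskerLD (one H) D ≈ (leftUnitorD S).comp (D.comp (leftUnitorInvD S')) :=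
  rel_comp (fun x => x.hom ≫ D.β.app x.right) (fun x => 𝟙 (D.f.obj x.right))
    (fun _ => (Category.comp_id _).trans (comp_map_id_aux S'.left rfl).symm)
    (fun m => ((whiskerLD (one H) D).f.map m).w) (fun m => nat_id_aux (D.f.map m.right))
    (fun x => (Category.id_comp _).trans
      (congrArg (fun m => x.hom ≫ m) (Category.comp_id (D.β.app x.right)).symm))
    (fun _ => map_id_comp_aux S'.right ((Category.comp_id _).trans (Category.id_comp _)))

theorem whiskerRD_one {T T' : FinSpan K H} (D : SpanDiagram T T') :
    (rightUnitorD T).comp (D.comp (rightUnitorInvD T')) ≈ whiskerRD D (one H) :=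
  rel_comp (fun x => 𝟙 (D.f.obj x.left)) (fun x => D.α.app x.left ≫ x.hom)
    (fun _ => (map_id_comp_aux T'.right rfl).trans (Category.id_comp _).symm)
    (fun m => nat_id_aux (D.f.map m.left)) (fun m => ((whiskerRD D (one H)).f.map m).w)
    (fun _ => comp_map_id_aux T'.left ((Category.id_comp _).trans (Category.comp_id _)))
    (fun x => (Category.comp_id _).trans
      (congrArg (fun m => m ≫ x.hom) (Category.id_comp (D.α.app x.left)).symm))

theorem comp_whiskerLD (R : FinSpan L K) (T : FinSpan K H) {S S' : FinSpan H G}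
    (D : SpanDiagram S S') :
    whiskerLD (comp R T) D ≈
      (assocD R T S).comp ((whiskerLD R (whiskerLD T D)).comp (assocInvD R T S')) :=
  rel_comp
    (fun x => ⟨𝟙 x.left.left, 𝟙 x.left.right,
      sq_id_aux R.right T.left (Category.comp_id x.left.hom).symm⟩)
    (fun x => 𝟙 (D.f.obj x.right))
    (fun _ => sq_id_aux T.right S'.left rfl)
    (fun m => CommaMorphism.ext (nat_id_aux m.left.left) (nat_id_aux m.left.right))
    (fun m => nat_id_aux (D.f.map m.right))
    (fun _ => comp_map_id_aux R.left
      ((Category.comp_id _).symm.trans (congrArg _ (Category.comp_id _).symm)))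
    (fun _ => map_id_comp_aux S'.right ((Category.comp_id _).trans (Category.id_comp _)))

theorem whiskerRD_comp_span {R R' : FinSpan L K} (D : SpanDiagram R R') (T : FinSpan K H)
    (S : FinSpan H G) :
    whiskerRD D (comp T S) ≈
      (assocInvD R T S).comp ((whiskerRD (whiskerRD D T) S).comp (assocD R' T S)) :=
  rel_comp (fun x => 𝟙 (D.f.obj x.left))
    (fun x => ⟨𝟙 x.right.left, 𝟙 x.right.right,
      sq_id_aux T.right S.left (Category.id_comp x.right.hom).symm⟩)
    (fun _ => sq_id_aux R'.right T.left rfl)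
    (fun m => nat_id_aux (D.f.map m.left))
    (fun m => CommaMorphism.ext (nat_id_aux m.right.left) (nat_id_aux m.right.right))
    (fun _ => comp_map_id_aux R'.left
      ((Category.comp_id _).symm.trans (Category.id_comp _).symm))
    (fun _ => map_id_comp_aux S.right ((Category.comp_id _).trans (Category.comp_id _)))

theorem whisker_assocD (R : FinSpan L K) {T T' : FinSpan K H} (D : SpanDiagram T T')
    (S : FinSpan H G) :
    whiskerRD (whiskerLD R D) S ≈
      (assocD R T S).comp ((whiskerLD R (whiskerRD D S)).comp (assocInvD R T' S)) :=
  SpanDiagram.rel_congr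
    (fun _ => (Category.comp_id _).symm.trans (congrArg _ (Category.comp_id _).symm))
    (fun _ => ((Category.comp_id _).trans (Category.comp_id _)).symm)

theorem pentagonD {F : FinGrpd.{u}} (Q : FinSpan F L) (R : FinSpan L K) (T : FinSpan K H)
    (S : FinSpan H G) :
    (whiskerRD (assocD Q R T) S).comp ((assocD Q (comp R T) S).comp (whiskerLD Q (assocD R T S))) ≈
      (assocD (comp Q R) T S).comp (assocD Q R (comp T S)) :=
  rel_comp (fun x => 𝟙 x.left.left.left)
    (fun x => ⟨𝟙 x.left.left.right, ⟨𝟙 x.left.right, 𝟙 x.right,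
      sq_id_aux T.right S.left (Category.id_comp x.hom)⟩, sq_id_aux R.right T.left rfl⟩)
    (fun x => sq_id_aux Q.right R.left (Category.comp_id x.left.left.hom))
    (fun m => nat_id_aux m.left.left.left)
    (fun m => CommaMorphism.ext (nat_id_aux m.left.left.right)
      (CommaMorphism.ext (nat_id_aux m.left.right) (nat_id_aux m.right)))
    (fun _ => comp_map_id_aux Q.left (Category.id_comp _))
    (fun _ => map_id_comp_aux S.right (Category.comp_id _).symm)

theorem triangleD (T : FinSpan K H) (S : FinSpan H G) :
    (assocD T (one H) S).comp (whiskerLD T (leftUnitorD S)) ≈ whiskerRD (rightUnitorD T) S :=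
  SpanDiagram.rel_congr (fun _ => Category.comp_id _) (fun _ => Category.comp_id _)

end FinSpan

/-- The objects of the bicategory of spans: all finite groupoids. -/
def SpanBicat : Type (u + 1) := FinGrpd.{u}

namespace SpanBicat

open FinSpan

instance : CategoryStruct.{u + 1} SpanBicat.{u} where
  Hom H G := FinSpan H G
  id G := one G
  comp T S := comp T S

/-- The bicategory of spans: 1-cells `H ⟶ G` are spans `H ← S → G`, 2-cells are isomorphism classes
of diagrams, and horizontal composition is formed with iso-comma groupoids. -/
instance : Bicategory.{u, u + 1} SpanBicat.{u} where
  homCategory H G := FinSpan.category H G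
  whiskerLeft T _ _ φ := whiskerL T φ
  whiskerRight φ S := whiskerR φ S
  associator R T S := associator R T S
  leftUnitor S := leftUnitor S
  rightUnitor S := rightUnitor S
  whiskerLeft_id T S := Quotient.sound (whiskerLD_id T S)
  whiskerLeft_comp T _ _ _ φ ψ :=
    Quotient.inductionOn₂ φ ψ fun D E => Quotient.sound (whiskerLD_comp T D E)
  id_whiskerLeft φ := Quotient.inductionOn φ fun D => Quotient.sound (id_whiskerLD D)
  comp_whiskerLeft R T _ _ φ :=
    Quotient.inductionOn φ fun D => Quotient.sound (comp_whiskerLD R T D)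
  id_whiskerRight T S := Quotient.sound (whiskerRD_id T S)
  comp_whiskerRight φ ψ S :=
    Quotient.inductionOn₂ φ ψ fun D E => Quotient.sound (whiskerRD_comp D E S)
  whiskerRight_id φ :=
    Quotient.inductionOn φ fun D => (Quotient.sound (whiskerRD_one D)).symm
  whiskerRight_comp φ T S :=
    Quotient.inductionOn φ fun D => Quotient.sound (whiskerRD_comp_span D T S)
  whisker_assoc R _ _ φ S :=
    Quotient.inductionOn φ fun D => Quotient.sound (whisker_assocD R D S)
  whisker_exchange φ ψ :=
    Quotient.inductionOn₂ φ ψ fun D E => Quotient.sound (exchangeD D E)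
  pentagon Q R T S := Quotient.sound (pentagonD Q R T S)
  triangle T S := Quotient.sound (triangleD T S)

end SpanBicat

/-! ### Realization -/

namespace FinBiset

variable {H G : FinGrpd.{u}}

/-- The biset `R_!(u) = G(u-, -) : H ⟶ G` of a functor `u : H ⥤ G`. -/
def lowerShriek (a : (H : Type u) ⥤ (G : Type u)) : FinBiset H G :=
  ofAct (fun h g => (a.obj h ⟶ g)) (fun β α ξ => a.map β ≫ ξ ≫ α) (by simp) (by simp)

/-- The biset `R^*(u) = G(-, u-) : G ⟶ H` of a functor `u : H ⥤ G`. -/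
def upperStar (b : (H : Type u) ⥤ (G : Type u)) : FinBiset G H :=
  ofAct (fun g h => (g ⟶ b.obj h)) (fun β α ξ => β ≫ ξ ≫ b.map α) (by simp) (by simp)

end FinBiset

namespace FinSpan

open FinBiset

variable {H G : FinGrpd.{u}}

/-- The realization `∫^{s ∈ S} G(a s, -) × H(-, b s)` of a span `H ← S → G` with legs `b`, `a`,
that is, the composite of the bisets `R^*(b)` and `R_!(a)`. -/
def realize (S : FinSpan H G) : FinBiset H G :=
  FinBiset.comp (upperStar S.left) (lowerShriek S.right)

/-- The class `[ξ, ζ]_s` of `ξ ∈ G(a s, g)` and `ζ ∈ H(h, b s)` in the realization of a span. -/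
def rmk (S : FinSpan H G) {h : H} {g : G} (s : S.apex) (ξ : S.right.obj s ⟶ g)
    (ζ : h ⟶ S.left.obj s) : S.realize.El h g :=
  cmk (V := upperStar S.left) (U := lowerShriek S.right) s ξ ζ

theorem rmk_map (S : FinSpan H G) {h : H} {g : G} {s t : S.apex} (f : s ⟶ t)
    (ξ : S.right.obj t ⟶ g) (ζ : h ⟶ S.left.obj s) :
    S.rmk s (S.right.map f ≫ ξ) ζ = S.rmk t ξ (ζ ≫ S.left.map f) := by
  have e := cmk_act (V := upperStar S.left) (U := lowerShriek S.right) (k := h) (g := g) f ξ ζ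
  change S.rmk s (S.right.map f ≫ ξ ≫ 𝟙 g) ζ = S.rmk t ξ (𝟙 h ≫ ζ ≫ S.left.map f) at e
  rwa [Category.comp_id, Category.id_comp] at e

theorem realize_ind (S : FinSpan H G) {h : H} {g : G} {P : S.realize.El h g → Prop}
    (w : ∀ s ξ ζ, P (S.rmk s ξ ζ)) (t : S.realize.El h g) : P t :=
  comp_ind (V := upperStar S.left) (U := lowerShriek S.right) w t

theorem act_rmk (S : FinSpan H G) {h h' : H} {g g' : G} (β : h' ⟶ h) (α : g ⟶ g') (s : S.apex)
    (ξ : S.right.obj s ⟶ g) (ζ : h ⟶ S.left.obj s) :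
    S.realize.act β α (S.rmk s ξ ζ) = S.rmk s (ξ ≫ α) (β ≫ ζ) := by
  change S.rmk s (S.right.map (𝟙 s) ≫ ξ ≫ α) (β ≫ ζ ≫ S.left.map (𝟙 s)) = _
  simp

/-- A morphism out of the realization of a span from its effect on classes `[ξ, ζ]_s`. -/
def realizeDesc (S : FinSpan H G) {W : FinBiset H G}
    (F : ∀ {h : H} {g : G} (s : S.apex), (S.right.obj s ⟶ g) → (h ⟶ S.left.obj s) → W.El h g)
    (w : ∀ {h : H} {g : G} {s t : S.apex} (f : s ⟶ t) (ξ : S.right.obj t ⟶ g)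
      (ζ : h ⟶ S.left.obj s), F s (S.right.map f ≫ ξ) ζ = F t ξ (ζ ≫ S.left.map f))
    (nat : ∀ {h h' : H} {g g' : G} (β : h' ⟶ h) (α : g ⟶ g') (s : S.apex) (ξ : S.right.obj s ⟶ g)
      (ζ : h ⟶ S.left.obj s), F s (ξ ≫ α) (β ≫ ζ) = W.act β α (F s ξ ζ)) : S.realize ⟶ W :=
  compDesc (V := upperStar S.left) (U := lowerShriek S.right) F
    (fun {_ _ s _} f ξ ζ =>
      ((congrArg (fun m => F s (S.right.map f ≫ m) ζ) (Category.comp_id _)).trans (w f ξ ζ)).trans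
        (congrArg (F _ ξ) (Category.id_comp _)).symm)
    (fun β α s ξ ζ =>
      (congrArg₂ (F s) (map_id_comp_aux S.right rfl)
        (congrArg (fun m => β ≫ m) (comp_map_id_aux S.left rfl))).trans (nat β α s ξ ζ))

theorem ev_realizeDesc (S : FinSpan H G) {W : FinBiset H G}
    (F : ∀ {h : H} {g : G} (s : S.apex), (S.right.obj s ⟶ g) → (h ⟶ S.left.obj s) → W.El h g)
    (w : ∀ {h : H} {g : G} {s t : S.apex} (f : s ⟶ t) (ξ : S.right.obj t ⟶ g)
      (ζ : h ⟶ S.left.obj s), F s (S.right.map f ≫ ξ) ζ = F t ξ (ζ ≫ S.left.map f))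
    (nat : ∀ {h h' : H} {g g' : G} (β : h' ⟶ h) (α : g ⟶ g') (s : S.apex) (ξ : S.right.obj s ⟶ g)
      (ζ : h ⟶ S.left.obj s), F s (ξ ≫ α) (β ≫ ζ) = W.act β α (F s ξ ζ))
    {h : H} {g : G} (s : S.apex) (ξ : S.right.obj s ⟶ g) (ζ : h ⟶ S.left.obj s) :
    ev (S.realizeDesc F w nat) (S.rmk s ξ ζ) = F s ξ ζ := rfl

/-- The morphism of bisets `[ξ, ζ]_s ↦ [ξ α_s, β_s ζ]_{f s}` induced by a diagram `(f, β, α)`. -/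
def realizeDiagram {S S' : FinSpan H G} (D : SpanDiagram S S') : S.realize ⟶ S'.realize :=
  S.realizeDesc (fun s ξ ζ => S'.rmk (D.f.obj s) (D.α.app s ≫ ξ) (ζ ≫ D.β.app s))
    (fun {h g s t} f ξ ζ => by
      have n := D.α.naturality f
      have n' := D.β.naturality f
      simp only [Functor.comp_map] at n n'
      rw [← reassoc_of% n, rmk_map, Category.assoc, Category.assoc, n'])
    (fun β α s ξ ζ => by rw [act_rmk, Category.assoc, Category.assoc])

theorem realizeDiagram_rel {S S' : FinSpan H G} {D E : SpanDiagram S S'} (e : D ≈ E) :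
    realizeDiagram D = realizeDiagram E := by
  obtain ⟨θ, h, k⟩ := e
  refine ev_ext fun x y t => realize_ind S (P := fun t => ev (realizeDiagram D) t =
    ev (realizeDiagram E) t) (fun s ξ ζ => ?_) t
  change S'.rmk (D.f.obj s) (D.α.app s ≫ ξ) (ζ ≫ D.β.app s) =
    S'.rmk (E.f.obj s) (E.α.app s ≫ ξ) (ζ ≫ E.β.app s)
  rw [← k, ← h, Category.assoc, rmk_map, Category.assoc]

/-- The morphism of bisets induced by a 2-cell `[f, β, α]` of spans. -/
def realizeCell {S S' : FinSpan H G} (φ : S ⟶ S') : S.realize ⟶ S'.realize :=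
  Quotient.lift realizeDiagram (fun _ _ e => realizeDiagram_rel e) φ

end FinSpan

/-- The data of the realization on objects (finite groupoids, sent to themselves), on spans (sent
to coends) and on 2-cells. -/
def realization : PrelaxFunctorStruct SpanBicat.{u} BisetBicat.{u} where
  obj G := G
  map S := FinSpan.realize S
  map₂ φ := FinSpan.realizeCell φ

namespace FinBiset

variable {H G : FinGrpd.{u}}

/-- An object of the groupoid `S(U)`: an element of some `U(h, g)`. -/
structure Elt (U : FinBiset H G) : Type u where
  h : H
  g : G
  val : U.El h g

/-- An arrow of `S(U)` from `x ∈ U(h, g)` to `x' ∈ U(h', g')`: a pair `(β, α)` of arrows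
`β : h ⟶ h'` and `α : g ⟶ g'` such that `U(1, α)(x) = U(β, 1)(x')`. -/
@[ext]
structure EltHom {U : FinBiset H G} (x y : Elt U) : Type u where
  β : x.h ⟶ y.h
  α : x.g ⟶ y.g
  w : U.act (𝟙 x.h) α x.val = U.act β (𝟙 y.g) y.val

instance eltGroupoid (U : FinBiset H G) : Groupoid.{u} (Elt U) where
  Hom x y := EltHom x y
  id x := ⟨𝟙 _, 𝟙 _, rfl⟩
  comp {x y z} m n := ⟨m.β ≫ n.β, m.α ≫ n.α, by
    have e := congrArg (U.act (𝟙 x.h) n.α) m.w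
    have e' := congrArg (U.act m.β (𝟙 z.g)) n.w
    simp only [act_act, Category.id_comp, Category.comp_id] at e e'
    exact e.trans e'⟩
  id_comp m := EltHom.ext (Category.id_comp _) (Category.id_comp _)
  comp_id m := EltHom.ext (Category.comp_id _) (Category.comp_id _)
  assoc m n p := EltHom.ext (Category.assoc _ _ _) (Category.assoc _ _ _)
  inv {x y} m := ⟨Groupoid.inv m.β, Groupoid.inv m.α, by
    have e := congrArg (U.act (Groupoid.inv m.β) (Groupoid.inv m.α)) m.w
    simp only [act_act, Category.id_comp, Category.comp_id, Groupoid.comp_inv,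
      Groupoid.inv_comp] at e
    exact e.symm⟩
  inv_comp m := EltHom.ext (Groupoid.inv_comp _) (Groupoid.inv_comp _)
  comp_inv m := EltHom.ext (Groupoid.comp_inv _) (Groupoid.comp_inv _)

/-- The finite groupoid `S(U)` of elements of a biset. -/
def eltGrpd (U : FinBiset H G) : FinGrpd.{u} where
  carrier := Elt U
  finite_obj := Finite.of_surjective
    (fun p : Σ h : H, Σ g : G, U.El h g => (⟨p.1, p.2.1, p.2.2⟩ : Elt U))
    fun x => ⟨⟨x.h, x.g, x.val⟩, rfl⟩
  finite_hom x y := Finite.of_injective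
    (fun m : EltHom x y => ((m.β, m.α) : (x.h ⟶ y.h) × (x.g ⟶ y.g)))
    fun _ _ e => EltHom.ext (congrArg Prod.fst e) (congrArg Prod.snd e)

/-- The span `H ← S(U) → G` of projections. -/
def eltSpan (U : FinBiset H G) : FinSpan H G where
  apex := eltGrpd U
  left :=
    { obj := fun x : Elt U => x.h
      map := fun {x y} (m : EltHom x y) => m.β
      map_id := fun _ => rfl
      map_comp := fun _ _ => rfl }
  right :=
    { obj := fun x : Elt U => x.g
      map := fun {x y} (m : EltHom x y) => m.α
      map_id := fun _ => rfl
      map_comp := fun _ _ => rfl }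

end FinBiset

/-!
The coends in play are quotients of explicit sets, so every morphism out of a realization
`∫^s G(a s, -) × H(-, b s)` is determined by its values on the classes `[ξ, ζ]_s`, and every
identity between such morphisms becomes a computation with arrows.

The realization is pseudo-functorial because of two isomorphisms. For the identity span the co-Yoneda
isomorphism `[ξ, ζ]_s ↦ ξ ∘ ζ` (`realizeOne`) identifies the realization with the Hom-biset. For
composable spans `K ← T → H` and `H ← S → G` with legs `d`, `c` and `b`, `a`, the assignment
`[ξ, ζ]_(t, s, γ) ↦ [[ξ, 1]_s, [γ, ζ]_t]_(b s)` has the inverse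
`[[ξ, ζ]_s, [ξ', ζ']_t]_h ↦ [ξ, ζ']_(t, s, ζ ∘ ξ')` (`realizeComp`): an element of
`∫^h H(c t, h) × H(h, b s)` is the same as an arrow `γ : c t ⟶ b s`, that is, as a way to complete
`(t, s)` to an object of the iso-comma groupoid.

For a biset `U`, evaluation `[α, β]_x ↦ U(β, α)(x)` respects the relations of the coend by the very
definition of the arrows of `S(U)`; its inverse sends `x` to `[1, 1]_x` (`realizeEltSpan`). The
inverse is natural since `α` is invertible: `(β, α⁻¹)` is an arrow from `U(β, α)(x)` to `x`.
-/

namespace FinSpan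

open FinBiset

variable {K L H G : FinGrpd.{u}}

/-! ### Classes in the realization of a span -/

/-- A morphism out of the realization of a span is determined by its values on the classes
`[ξ, ζ]_s`. -/
theorem realize_hom_ext {S : FinSpan H G} {W : FinBiset H G} {φ ψ : S.realize ⟶ W}
    (w : ∀ {h : H} {g : G} (s : S.apex) (ξ : S.right.obj s ⟶ g) (ζ : h ⟶ S.left.obj s),
      ev φ (S.rmk s ξ ζ) = ev ψ (S.rmk s ξ ζ)) : φ = ψ :=
  ev_ext fun _ _ t => realize_ind S (P := fun t => ev φ t = ev ψ t) w t

/-- The universal property of the coend `∫^s G(a s, g) × H(h, b s)` as a set. -/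
def realizeLift (S : FinSpan H G) {h : H} {g : G} {X : Type u}
    (F : ∀ s : S.apex, (S.right.obj s ⟶ g) → (h ⟶ S.left.obj s) → X)
    (w : ∀ {s t : S.apex} (f : s ⟶ t) (ξ : S.right.obj t ⟶ g) (ζ : h ⟶ S.left.obj s),
      F s (S.right.map f ≫ ξ) ζ = F t ξ (ζ ≫ S.left.map f)) (x : S.realize.El h g) : X :=
  Tensor.lift (V := upperStar S.left) (U := lowerShriek S.right) F
    (fun {s _} f ξ ζ =>
      ((congrArg (fun m => F s (S.right.map f ≫ m) ζ) (Category.comp_id _)).trans (w f ξ ζ)).trans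
        (congrArg (F _ ξ) (Category.id_comp _)).symm) x

@[simp]
theorem realizeLift_rmk (S : FinSpan H G) {h : H} {g : G} {X : Type u}
    (F : ∀ s : S.apex, (S.right.obj s ⟶ g) → (h ⟶ S.left.obj s) → X)
    (w : ∀ {s t : S.apex} (f : s ⟶ t) (ξ : S.right.obj t ⟶ g) (ζ : h ⟶ S.left.obj s),
      F s (S.right.map f ≫ ξ) ζ = F t ξ (ζ ≫ S.left.map f))
    (s : S.apex) (ξ : S.right.obj s ⟶ g) (ζ : h ⟶ S.left.obj s) :
    S.realizeLift F w (S.rmk s ξ ζ) = F s ξ ζ := rfl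

theorem realizeCell_id (S : FinSpan H G) : realizeCell (𝟙 S) = 𝟙 S.realize :=
  realize_hom_ext fun s ξ ζ => congrArg₂ (S.rmk s) (Category.id_comp ξ) (Category.comp_id ζ)

theorem realizeCell_comp {S S' S'' : FinSpan H G} (φ : S ⟶ S') (ψ : S' ⟶ S'') :
    realizeCell (φ ≫ ψ) = realizeCell φ ≫ realizeCell ψ := by
  induction φ using hom_ind with
  | w D =>
  induction ψ using hom_ind with
  | w E =>
  exact realize_hom_ext fun s ξ ζ => congrArg₂ (S''.rmk (E.f.obj (D.f.obj s)))
    (Category.assoc _ _ _) (Category.assoc _ _ _).symm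

/-! ### The realization of the identity span -/

/-- The isomorphism `[ξ, ζ]_s ↦ ξ ∘ ζ` from the realization of the identity span to the identity
biset. -/
def realizeOne (G : FinGrpd.{u}) : (one G).realize ≅ FinBiset.one G where
  hom := (one G).realizeDesc (fun _ ξ ζ => toOne (ζ ≫ ξ))
    (fun f ξ ζ => congrArg toOne (Category.assoc ζ f ξ).symm)
    (fun β α s ξ ζ => by simp)
  inv := mkHom (fun h _ ξ => (one G).rmk h (ofOne ξ) (𝟙 h)) (fun {h h' g g'} β α ξ => by
    refine ((one G).rmk_map β (ofOne ξ ≫ α) (𝟙 h')).trans ?_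
    rw [act_rmk]
    exact congrArg ((one G).rmk h _) (nat_id_aux β).symm)
  hom_inv_id := realize_hom_ext fun {h _} s ξ ζ =>
    ((one G).rmk_map ζ ξ (𝟙 h)).trans (congrArg ((one G).rmk s ξ) (Category.id_comp ζ))
  inv_hom_id := ev_ext fun h g ξ => congrArg toOne (Category.id_comp (ofOne ξ))

/-! ### The realization of a composite span -/

/-- The morphism `[ξ, ζ]_(t, s, γ) ↦ [[ξ, 1]_s, [γ, ζ]_t]_(b s)`. -/
def realizeCompHom (T : FinSpan K H) (S : FinSpan H G) :
    (comp T S).realize ⟶ FinBiset.comp T.realize S.realize :=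
  (comp T S).realizeDesc
    (fun x ξ ζ => cmk (S.left.obj x.right) (S.rmk x.right ξ (𝟙 _)) (T.rmk x.left x.hom ζ))
    (fun {h g x y} f ξ ζ => by
      have w := f.w
      have e : S.rmk x.right (S.right.map f.right ≫ ξ) (𝟙 _) =
          S.realize.act (S.left.map f.right) (𝟙 g) (S.rmk y.right ξ (𝟙 _)) := by
        rw [rmk_map, act_rmk, Category.id_comp, Category.comp_id, Category.comp_id]
      refine (congrArg (fun z => cmk _ z (T.rmk x.left x.hom ζ)) e).trans ?_
      rw [cmk_act, act_rmk, Category.id_comp]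
      refine congrArg (cmk _ _) ?_
      rw [← w, rmk_map]
      rfl)
    (fun β α x ξ ζ => by
      rw [act_cmk, act_rmk, act_rmk, Category.comp_id, Category.comp_id])

/-- The morphism `[[ξ, ζ]_s, [ξ', ζ']_t]_h ↦ [ξ, ζ']_(t, s, ζ ∘ ξ')`. -/
def realizeCompInv (T : FinSpan K H) (S : FinSpan H G) :
    FinBiset.comp T.realize S.realize ⟶ (comp T S).realize :=
  compDesc
    (fun {k g} h x y => S.realizeLift
      (fun s ξ ζ => T.realizeLift
        (fun t ξ' ζ' => (comp T S).rmk (⟨t, s, ξ' ≫ ζ⟩ : Comma T.right S.left) ξ ζ')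
        (fun {t t'} f ξ' ζ' => by
          let m : (⟨t, s, (T.right.map f ≫ ξ') ≫ ζ⟩ : Comma T.right S.left) ⟶ ⟨t', s, ξ' ≫ ζ⟩ :=
            ⟨f, 𝟙 s, by simp⟩
          have e := (comp T S).rmk_map m ξ ζ'
          exact (congrArg (fun n => (comp T S).rmk
            (⟨t, s, (T.right.map f ≫ ξ') ≫ ζ⟩ : Comma T.right S.left) n ζ')
            (map_id_comp_aux S.right rfl).symm).trans e) y)
      (fun {s s'} f ξ ζ => by
        induction y using realize_ind with
        | w t ξ' ζ' =>
        let m : (⟨t, s, ξ' ≫ ζ⟩ : Comma T.right S.left) ⟶ ⟨t, s', ξ' ≫ ζ ≫ S.left.map f⟩ :=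
          ⟨𝟙 t, f, by simp⟩
        have e := (comp T S).rmk_map m ξ ζ'
        exact e.trans (congrArg
          ((comp T S).rmk (⟨t, s', ξ' ≫ ζ ≫ S.left.map f⟩ : Comma T.right S.left) ξ)
          (comp_map_id_aux T.left rfl))) x)
    (fun f x y => by
      induction x using realize_ind with
      | w s ξ ζ =>
      induction y using realize_ind with
      | w t ξ' ζ' =>
      rw [act_rmk, act_rmk, realizeLift_rmk, realizeLift_rmk, realizeLift_rmk, realizeLift_rmk,
        Category.comp_id, Category.id_comp, Category.assoc])
    (fun β α h x y => by
      induction x using realize_ind with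
      | w s ξ ζ =>
      induction y using realize_ind with
      | w t ξ' ζ' =>
      rw [act_rmk, act_rmk, realizeLift_rmk, realizeLift_rmk, realizeLift_rmk, realizeLift_rmk,
        act_rmk, Category.comp_id, Category.id_comp])

@[simp]
theorem ev_realizeCompHom (T : FinSpan K H) (S : FinSpan H G) {k : K} {g : G}
    (x : Comma T.right S.left) (ξ : S.right.obj x.right ⟶ g) (ζ : k ⟶ T.left.obj x.left) :
    ev (realizeCompHom T S) ((comp T S).rmk x ξ ζ) =
      cmk (S.left.obj x.right) (S.rmk x.right ξ (𝟙 _)) (T.rmk x.left x.hom ζ) := rfl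

@[simp]
theorem ev_realizeCompInv (T : FinSpan K H) (S : FinSpan H G) {k : K} {h : H} {g : G} (s : S.apex)
    (ξ : S.right.obj s ⟶ g) (ζ : h ⟶ S.left.obj s) (t : T.apex) (ξ' : T.right.obj t ⟶ h)
    (ζ' : k ⟶ T.left.obj t) :
    ev (realizeCompInv T S) (cmk h (S.rmk s ξ ζ) (T.rmk t ξ' ζ')) =
      (comp T S).rmk (⟨t, s, ξ' ≫ ζ⟩ : Comma T.right S.left) ξ ζ' := rfl

/-- The realization of a composite span is the composite of the realizations. -/
def realizeComp (T : FinSpan K H) (S : FinSpan H G) :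
    (comp T S).realize ≅ FinBiset.comp T.realize S.realize where
  hom := realizeCompHom T S
  inv := realizeCompInv T S
  hom_inv_id := realize_hom_ext fun x ξ ζ => by
    rw [ev_comp, ev_realizeCompHom, ev_realizeCompInv, Category.comp_id, ev_id]
  inv_hom_id := comp_hom_ext fun {_ g} h x y => by
    induction x using realize_ind with
    | w s ξ ζ =>
    induction y using realize_ind with
    | w t ξ' ζ' =>
    rw [ev_comp, ev_realizeCompInv, ev_realizeCompHom, ev_id]
    -- The arrow `ζ : h ⟶ b s` is moved across the tensor sign.
    have e := cmk_act (V := T.realize) (U := S.realize) ζ (S.rmk s ξ (𝟙 _)) (T.rmk t ξ' ζ')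
    rw [act_rmk, act_rmk, Category.comp_id, Category.comp_id, Category.id_comp] at e
    exact e.symm

/-! ### Coherence -/

theorem realizeCell_whiskerL (T : FinSpan K H) {S S' : FinSpan H G} (φ : S ⟶ S') :
    realizeCell (whiskerL T φ) = (realizeComp T S).hom ≫
      FinBiset.whiskerL T.realize (realizeCell φ) ≫ (realizeComp T S').inv := by
  induction φ using hom_ind with
  | w D =>
  refine realize_hom_ext fun x ξ ζ => ?_
  change (comp T S').rmk (⟨x.left, D.f.obj x.right, x.hom ≫ D.β.app x.right⟩ :
      Comma T.right S'.left) (D.α.app x.right ≫ ξ) (ζ ≫ 𝟙 _) =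
    (comp T S').rmk (⟨x.left, D.f.obj x.right, x.hom ≫ 𝟙 _ ≫ D.β.app x.right⟩ :
      Comma T.right S'.left) (D.α.app x.right ≫ ξ) ζ
  rw [Category.id_comp, Category.comp_id]

theorem realizeCell_whiskerR {T T' : FinSpan K H} (φ : T ⟶ T') (S : FinSpan H G) :
    realizeCell (whiskerR φ S) = (realizeComp T S).hom ≫
      FinBiset.whiskerR (realizeCell φ) S.realize ≫ (realizeComp T' S).inv := by
  induction φ using hom_ind with
  | w D =>
  refine realize_hom_ext fun x ξ ζ => ?_
  change (comp T' S).rmk (⟨D.f.obj x.left, x.right, D.α.app x.left ≫ x.hom⟩ :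
      Comma T'.right S.left) (𝟙 _ ≫ ξ) (ζ ≫ D.β.app x.left) =
    (comp T' S).rmk (⟨D.f.obj x.left, x.right, (D.α.app x.left ≫ x.hom) ≫ 𝟙 _⟩ :
      Comma T'.right S.left) ξ (ζ ≫ D.β.app x.left)
  rw [Category.id_comp, Category.comp_id]

theorem realizeCell_associator (R : FinSpan L K) (T : FinSpan K H) (S : FinSpan H G) :
    realizeCell (associator R T S).hom = (realizeComp (comp R T) S).hom ≫
      FinBiset.whiskerR (realizeComp R T).hom S.realize ≫
      (FinBiset.associator R.realize T.realize S.realize).hom ≫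
      FinBiset.whiskerL R.realize (realizeComp T S).inv ≫ (realizeComp R (comp T S)).inv := by
  refine realize_hom_ext fun x ξ ζ => ?_
  change (comp R (comp T S)).rmk (⟨x.left.left, ⟨x.left.right, x.right, x.hom⟩, x.left.hom⟩ :
      Comma R.right (comp T S).left) (𝟙 _ ≫ ξ) (ζ ≫ 𝟙 _) =
    (comp R (comp T S)).rmk (⟨x.left.left, ⟨x.left.right, x.right, x.hom ≫ 𝟙 _⟩,
      x.left.hom ≫ 𝟙 _⟩ : Comma R.right (comp T S).left) ξ ζ
  rw [Category.id_comp, Category.comp_id, Category.comp_id, Category.comp_id]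

theorem realizeCell_leftUnitor (S : FinSpan H G) :
    realizeCell (leftUnitor S).hom = (realizeComp (one H) S).hom ≫
      FinBiset.whiskerR (realizeOne H).hom S.realize ≫ (FinBiset.leftUnitor S.realize).hom := by
  refine realize_hom_ext fun {_ g} x ξ ζ => ?_
  refine Eq.trans ?_ (act_rmk S (ζ ≫ x.hom) (𝟙 g) x.right ξ (𝟙 _)).symm
  rw [Category.comp_id, Category.comp_id]
  exact congrArg (fun m => S.rmk x.right m (ζ ≫ x.hom)) (Category.id_comp ξ)

theorem realizeCell_rightUnitor (S : FinSpan H G) :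
    realizeCell (rightUnitor S).hom = (realizeComp S (one G)).hom ≫
      FinBiset.whiskerL S.realize (realizeOne G).hom ≫ (FinBiset.rightUnitor S.realize).hom := by
  refine realize_hom_ext fun {h _} x ξ ζ => ?_
  refine Eq.trans ?_ (act_rmk S (𝟙 h) (𝟙 x.right ≫ ξ) x.left x.hom ζ).symm
  exact congrArg₂ (S.rmk x.left) (congrArg (fun m => x.hom ≫ m) (Category.id_comp ξ).symm)
    (nat_id_aux ζ)

/-! ### Bisets as realizations of spans -/

/-- The evaluation morphism `[α, β]_x ↦ U(β, α)(x)` out of the realization of the span of elements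
of a biset. -/
def eltSpanEval (U : FinBiset H G) : (eltSpan U).realize ⟶ U :=
  (eltSpan U).realizeDesc (fun (x : Elt U) α β => U.act β α x.val)
    (fun {h g} (x y : Elt U) (f : EltHom x y) (α : y.g ⟶ g) (β : h ⟶ x.h) => by
      have e := congrArg (U.act β α) f.w
      rw [act_act, act_act, Category.comp_id, Category.id_comp] at e
      exact e)
    (fun β α x ξ ζ => (act_act U ζ ξ β α x.val).symm)

/-- The morphism `x ↦ [1, 1]_x` into the realization of the span of elements of a biset. -/
def eltSpanUnit (U : FinBiset H G) : U ⟶ (eltSpan U).realize :=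
  mkHom (fun h g x => (eltSpan U).rmk (⟨h, g, x⟩ : Elt U) (𝟙 g) (𝟙 h))
    (fun {h h' g g'} β α x => by
      let m : EltHom (⟨h', g', U.act β α x⟩ : Elt U) ⟨h, g, x⟩ := ⟨β, Groupoid.inv α, by simp⟩
      have e := (eltSpan U).rmk_map (s := (⟨h', g', U.act β α x⟩ : Elt U))
        (t := (⟨h, g, x⟩ : Elt U)) m α (𝟙 h')
      refine Eq.trans ?_ ((e.trans ?_).trans
        (act_rmk (eltSpan U) β α (⟨h, g, x⟩ : Elt U) (𝟙 g) (𝟙 h)).symm)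
      · exact congrArg (fun n => (eltSpan U).rmk (⟨h', g', U.act β α x⟩ : Elt U) n (𝟙 h'))
          (Groupoid.inv_comp α).symm
      · exact congrArg₂ ((eltSpan U).rmk (⟨h, g, x⟩ : Elt U)) (Category.id_comp α).symm
          (nat_id_aux β).symm)

/-- Every biset is the realization of its span of elements, through evaluation. -/
def realizeEltSpan (U : FinBiset H G) : (eltSpan U).realize ≅ U where
  hom := eltSpanEval U
  inv := eltSpanUnit U
  hom_inv_id := realize_hom_ext fun {h g} (x : Elt U) (α : x.g ⟶ g) (β : h ⟶ x.h) =>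
    ((ev_act (eltSpanUnit U) β α x.val).trans
      (act_rmk (eltSpan U) β α x (𝟙 x.g) (𝟙 x.h))).trans
      (congrArg₂ ((eltSpan U).rmk x) (Category.id_comp α) (Category.comp_id β))
  inv_hom_id := ev_ext fun _ _ x => act_id U x

end FinSpan

/-! ### The pseudo-functor -/

open FinSpan in
/-- The realization of spans as a pseudo-functor. -/
def realizationPseudofunctor : CategoryTheory.Pseudofunctor SpanBicat.{u} BisetBicat.{u} where
  toPrelaxFunctorStruct := realization
  map₂_id S := realizeCell_id S
  map₂_comp φ ψ := realizeCell_comp φ ψ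
  mapId G := realizeOne G
  mapComp T S := realizeComp T S
  map₂_whisker_left T _ _ φ := realizeCell_whiskerL T φ
  map₂_whisker_right φ S := realizeCell_whiskerR φ S
  map₂_associator R T S := realizeCell_associator R T S
  map₂_left_unitor S := realizeCell_leftUnitor S
  map₂_right_unitor S := realizeCell_rightUnitor S

/-- **Comparison of spans and bisets.** There is a pseudo-functor `R` which is the identity on
objects and realizes spans as coends; and every biset `U` is isomorphic to the realization of the
span `H ← S(U) → G`, through the evaluation `[α, β]_x ↦ U(β, α)(x)`. -/
theorem theorem1p1 :
    ∃ R : CategoryTheory.Pseudofunctor SpanBicat.{u} BisetBicat.{u},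
      R.toPrelaxFunctor.toPrelaxFunctorStruct = realization ∧
      ∀ (H G : FinGrpd.{u}) (U : FinBiset H G),
        ∃ e : FinSpan.realize (FinBiset.eltSpan U) ≅ U,
          ∀ (h : H) (g : G) (x : FinBiset.Elt U) (α : x.g ⟶ g) (β : h ⟶ x.h),
            FinBiset.ev e.hom (FinSpan.rmk (FinBiset.eltSpan U) x α β) =
              FinBiset.act U β α x.val :=
  ⟨realizationPseudofunctor, rfl, fun _ _ U =>
    ⟨FinSpan.realizeEltSpan U, fun _ _ _ _ _ => rfl⟩⟩
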